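/- Let $\Delta_+$ be the category of finite totally ordered sets (including the empty set) and order-preserving maps. An augmented cosimplicial space is a functor $X^\bullet\colon\Delta_+\to\mathrm{Top}$, $S\mapsto X^S$; write $[0]=\{0\}$ and $X^0=X^{[0]}$. Let $\Delta^\bullet$ be the augmented cosimplicial space which takes $S$ to the simplex $\Delta^S=\{u\in[0,1]^S : \sum_{a\in S}u_a=1\}$ with vertex set $S$ (so $\Delta^\emptyset=\emptyset$) and an order-preserving map $h\colon S\to T$ to the induced affine map $(h_*u)_b=\sum_{a\in h^{-1}(b)}u_a$. For $k\ge 0$ let $\bar k=\{1,\dots,k\}$ (so $\bar 0=\emptyset$), and let $\mathcal Q_k$ be the category whose objects are the pairs $(f,S)$ with $S\in\Delta_+$ and $f\colon S\to\bar k$ a map of sets, and whose morphisms $(f,S)\to(g,T)$ are the order-preserving maps $h\colon S\to T$ with $g\circ h=f$. Let $\Phi\colon\mathcal Q_k\to\Delta_+$ be the functor $(f,S)\mapsto S$. For augmented cosimplicial spaces $X_1^\bullet,\dots,X_k^\bullet$ let $\Xi_k(X_1^\bullet,\dots,X_k^\bullet)$ be the augmented cosimplicial space obtained as the left Kan extension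 along $\Phi$ of the functor $$\mathcal Q_k\to\mathrm{Top},\qquad (f,S)\mapsto X_1^{f^{-1}(1)}\times\cdots\times X_k^{f^{-1}(k)} .$$ Put $Y_k^\bullet=\Xi_k(\Delta^\bullet,\dots,\Delta^\bullet)$. Then, for every $k\ge 0$, the space $Y_k^0$ is contractible. -/

import Mathlib

open CategoryTheory CategoryTheory.Limits

/-- A finite totally ordered set, possibly empty. -/
structure FinLinOrd where
  /-- The underlying set. -/
  carrier : Type
  [linearOrder : LinearOrder carrier]
  [fintype : Fintype carrier]

namespace FinLinOrd

attribute [instance] FinLinOrd.linearOrder FinLinOrd.fintype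

instance : CoeSort FinLinOrd Type where
  coe S := S.carrier

/-- Bundle a finite linear order. -/
abbrev of (α : Type) [LinearOrder α] [Fintype α] : FinLinOrd where
  carrier := α

/-- The category `Δ₊` of finite totally ordered sets (including the empty one) and
order-preserving (i.e. weakly monotone) maps. -/
instance : Category FinLinOrd where
  Hom S T := S →o T
  id _ := OrderHom.id
  comp f g := g.comp f

/-- The order-preserving map underlying a morphism of `Δ₊`. -/
abbrev toMap {S T : FinLinOrd} (h : S ⟶ T) : S →o T := h

end FinLinOrd

/-- An augmented cosimplicial space: a functor from `Δ₊` to topological spaces. -/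
abbrev AugCosimplicialSpace := FinLinOrd ⥤ TopCat.{0}

/-- The augmented cosimplicial space `Δ^•`, which takes `S` to the simplex
`{u : S → ℝ | 0 ≤ u, ∑ a, u a = 1}` with vertex set `S` (so that it takes `∅` to `∅`) and an
order-preserving map to the affine map which it induces. -/
noncomputable def simplexFunctor : AugCosimplicialSpace where
  obj S := TopCat.of (stdSimplex ℝ S)
  map {S T} h := TopCat.ofHom
    ⟨stdSimplex.map (S := ℝ) (FinLinOrd.toMap h), stdSimplex.continuous_map (FinLinOrd.toMap h)⟩
  map_id S := by
    refine TopCat.hom_ext (ContinuousMap.ext fun u => ?_)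
    exact stdSimplex.map_id_apply u
  map_comp {S T U} h g := by
    refine TopCat.hom_ext (ContinuousMap.ext fun u => ?_)
    exact (stdSimplex.map_comp_apply (FinLinOrd.toMap h) (FinLinOrd.toMap g) u).symm

/-- An object of the category `Q_k`: a finite totally ordered set `S` with a map of sets
`f : S → {1, …, k}`. -/
structure QObj (k : ℕ) where
  /-- The finite totally ordered set. -/
  set : FinLinOrd
  /-- The map of sets. -/
  f : set → Fin k

namespace QObj

variable {k : ℕ}

/-- The morphisms `(f, S) ⟶ (g, T)` of `Q_k` are the order-preserving `h : S → T` with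
`g ∘ h = f`. -/
instance : Category (QObj k) where
  Hom A B := {h : A.set →o B.set // ∀ a, B.f (h a) = A.f a}
  id _ := ⟨OrderHom.id, fun _ => rfl⟩
  comp h g := ⟨g.1.comp h.1, fun a => (g.2 (h.1 a)).trans (h.2 a)⟩

/-- The forgetful functor `Φ : Q_k ⥤ Δ₊`, `(f, S) ↦ S`. -/
def forget (k : ℕ) : QObj k ⥤ FinLinOrd where
  obj A := A.set
  map h := h.1

/-- The fibre `f⁻¹(i)`, with the order induced from `S`. -/
abbrev fibre (A : QObj k) (i : Fin k) : FinLinOrd := FinLinOrd.of {a : A.set // A.f a = i}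

/-- The map which a morphism of `Q_k` induces on the fibres over `i`. -/
def fibreMap {A B : QObj k} (h : A ⟶ B) (i : Fin k) : A.fibre i →o B.fibre i where
  toFun a := ⟨h.1 a.1, (h.2 a.1).trans a.2⟩
  monotone' _ _ hab := h.1.monotone hab

/-- The functor `Ψ : Q_k ⥤ Δ₊ × ⋯ × Δ₊`, `(f, S) ↦ (f⁻¹(1), …, f⁻¹(k))`. -/
def fibres (k : ℕ) : QObj k ⥤ (Fin k → FinLinOrd) where
  obj A i := A.fibre i
  map h i := fibreMap h i

end QObj

/-- The functor `Top × ⋯ × Top ⥤ Top`, the Cartesian product with the product topology. -/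
def topProd (k : ℕ) : (Fin k → TopCat.{0}) ⥤ TopCat.{0} where
  obj Y := TopCat.of (∀ i, Y i)
  map {Y Z} φ := TopCat.ofHom
    ⟨fun y i => (φ i) (y i),
      continuous_pi fun i => (φ i).hom.continuous.comp (continuous_apply i)⟩

/-- The functor `X₁ ×̄ ⋯ ×̄ X_k : Δ₊ × ⋯ × Δ₊ ⥤ Top`,
`(S₁, …, S_k) ↦ X₁^{S₁} × ⋯ × X_k^{S_k}`. -/
def extProd {k : ℕ} (X : Fin k → AugCosimplicialSpace) : (Fin k → FinLinOrd) ⥤ TopCat.{0} :=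
  Functor.pi X ⋙ topProd k

/-! `Q_k` is essentially small and `Δ₊` is locally small, so that the Kan extension below exists. -/

instance : LocallySmall.{0} FinLinOrd where
  hom_small S T := inferInstanceAs (Small.{0} (S →o T))

instance (k : ℕ) : EssentiallySmall.{0} (QObj k) := by
  rw [essentiallySmall_iff]
  refine ⟨?_, ⟨fun A B => inferInstanceAs
    (Small.{0} {h : A.set →o B.set // ∀ a, B.f (h a) = A.f a})⟩⟩
  refine small_of_surjective
    (f := fun p : (n : ℕ) × (Fin n → Fin k) =>
      toSkeleton (QObj.mk (k := k) (FinLinOrd.of (Fin p.1)) p.2)) fun s => ?_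
  obtain ⟨A, rfl⟩ : ∃ A : QObj k, toSkeleton A = s := ⟨_, Quotient.out_eq s⟩
  have e : A.set ≃o Fin (Fintype.card A.set) := (Fintype.orderIsoFinOfCardEq A.set rfl).symm
  refine ⟨⟨Fintype.card A.set, fun b => A.f (e.symm b)⟩, congr_toSkeleton_of_iso ?_⟩
  exact { hom := ⟨(e.symm : Fin (Fintype.card A.set) →o A.set), fun _ => rfl⟩
          inv := ⟨(e : A.set →o Fin (Fintype.card A.set)),
            fun a => congrArg A.f (e.symm_apply_apply a)⟩
          hom_inv_id := Subtype.ext (OrderHom.ext _ _ (funext fun b => e.apply_symm_apply b))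
          inv_hom_id := Subtype.ext (OrderHom.ext _ _ (funext fun a => e.symm_apply_apply a)) }

instance (k : ℕ) (S : FinLinOrd) :
    HasColimitsOfShape (CostructuredArrow (QObj.forget k) S) TopCat.{0} :=
  hasColimitsOfShape_of_essentiallySmall.{0} _ _

instance (k : ℕ) (F : QObj k ⥤ TopCat.{0}) :
    (QObj.forget k).HasPointwiseLeftKanExtension F :=
  fun S => inferInstanceAs
    (HasColimit (CostructuredArrow.proj (QObj.forget k) S ⋙ F))

/-- The augmented cosimplicial space `Ξ_k(X₁, …, X_k)`: the left Kan extension of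
`(X₁ ×̄ ⋯ ×̄ X_k) ∘ Ψ` along `Φ`. -/
noncomputable def Xi {k : ℕ} (X : Fin k → AugCosimplicialSpace) : AugCosimplicialSpace :=
  (QObj.forget k).leftKanExtension (QObj.fibres k ⋙ extProd X)

/-- The augmented cosimplicial space `Y_k = Ξ_k(Δ^•, …, Δ^•)`. -/
noncomputable def XiSimplex (k : ℕ) : AugCosimplicialSpace := Xi fun _ : Fin k => simplexFunctor

/-- The totally ordered set `[m] = {0, …, m}`. -/
abbrev ordinalSet (m : ℕ) : FinLinOrd := FinLinOrd.of (Fin (m + 1))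

/-! Since `[0]` is terminal in `Δ₊`, `Y_k^0` is the colimit over all of `Q_k` of the products of
simplices. Given `u` over `(f, S)`, put a copy of `{1, …, k}` in front of `S`. Every fibre then
gains a new vertex, and a straight line joins the image of `u` to the tuple of new vertices. The
colimit identifies the start of this line with `u`, via the back inclusion, and its end with one
point independent of `u`, via the front inclusion (`map_incl`). The lines are natural in `(f, S)`
(`map_contract`), so they glue to a contraction. -/

open scoped unitInterval

namespace stdSimplex

variable {X Y : Type*} [Fintype X] [Fintype Y]

/-- The segment from `y` to `x` in a standard simplex. -/
noncomputable def segment (t : I) (x y : stdSimplex ℝ X) : stdSimplex ℝ X :=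
  ⟨(t : ℝ) • x.1 + (1 - (t : ℝ)) • y.1,
    convex_stdSimplex ℝ X x.2 y.2 t.2.1 (sub_nonneg.2 t.2.2) (add_sub_cancel _ _)⟩

lemma segment_zero (x y : stdSimplex ℝ X) : segment 0 x y = y :=
  Subtype.ext (by simp [segment])

lemma segment_one (x y : stdSimplex ℝ X) : segment 1 x y = x :=
  Subtype.ext (by simp [segment])

lemma map_segment (f : X → Y) (t : I) (x y : stdSimplex ℝ X) :
    map f (segment t x y) = segment t (map f x) (map f y) := by
  refine Subtype.ext ?_
  change FunOnFinite.linearMap ℝ ℝ f ((t : ℝ) • x.1 + (1 - (t : ℝ)) • y.1) =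
    (t : ℝ) • FunOnFinite.linearMap ℝ ℝ f x.1 + (1 - (t : ℝ)) • FunOnFinite.linearMap ℝ ℝ f y.1
  rw [map_add, map_smul, map_smul]

lemma continuous_segment (x : stdSimplex ℝ X) :
    Continuous fun p : I × stdSimplex ℝ X => segment p.1 x p.2 := by
  refine Continuous.subtype_mk ?_ _
  have h : Continuous fun p : I × stdSimplex ℝ X => p.2.1 :=
    continuous_subtype_val.comp continuous_snd
  fun_prop

end stdSimplex

namespace QObj

variable {k : ℕ}

/-- The object `id : {1, …, k} → {1, …, k}` of `Q_k`. -/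
def base (k : ℕ) : QObj k := ⟨FinLinOrd.of (Fin k), id⟩

/-- The object of `Q_k` obtained by putting `{1, …, k}` in front of `S`. -/
def prepend (A : QObj k) : QObj k :=
  ⟨FinLinOrd.of (Fin k ⊕ₗ A.set), fun a => Sum.elim id A.f (ofLex a)⟩

/-- Putting `{1, …, k}` in front is functorial. -/
def prependMap {A B : QObj k} (h : A ⟶ B) : A.prepend ⟶ B.prepend :=
  ⟨⟨fun a => toLex (Sum.map id h.1 (ofLex a)), by
    rintro (a | a) (b | b) hab
    · exact Sum.Lex.inl_le_inl_iff.2 (Sum.Lex.inl_le_inl_iff.1 hab)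
    · exact Sum.Lex.inl_le_inr _ _
    · exact absurd hab Sum.Lex.not_inr_le_inl
    · exact Sum.Lex.inr_le_inr_iff.2 (h.1.monotone (Sum.Lex.inr_le_inr_iff.1 hab))⟩, by
    rintro (a | a)
    · rfl
    · exact h.2 a⟩

/-- The inclusion of the front part. -/
def prependInl (A : QObj k) : base k ⟶ A.prepend :=
  ⟨⟨fun a => toLex (Sum.inl a), fun _ _ hab => Sum.Lex.inl_le_inl_iff.2 hab⟩, fun _ => rfl⟩

/-- The inclusion of the back part. -/
def prependInr (A : QObj k) : A ⟶ A.prepend :=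
  ⟨⟨fun a => toLex (Sum.inr a), fun _ _ hab => Sum.Lex.inr_le_inr_iff.2 hab⟩, fun _ => rfl⟩

lemma prependInl_comp_prependMap {A B : QObj k} (h : A ⟶ B) :
    A.prependInl ≫ prependMap h = B.prependInl := rfl

lemma prependInr_comp_prependMap {A B : QObj k} (h : A ⟶ B) :
    A.prependInr ≫ prependMap h = h ≫ B.prependInr := rfl

/-- The functor `Q_k ⥤ Top`, `(f, S) ↦ Δ^{f⁻¹(1)} × ⋯ × Δ^{f⁻¹(k)}`. -/
noncomputable abbrev simplices (k : ℕ) : QObj k ⥤ TopCat.{0} :=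
  fibres k ⋙ extProd fun _ : Fin k => simplexFunctor

lemma simplices_map_apply {A B : QObj k} (h : A ⟶ B) (u : (simplices k).obj A) (i : Fin k) :
    (simplices k).map h u i = stdSimplex.map (S := ℝ) (fibreMap h i) (u i) := rfl

/-- The point of `Δ^{{1}} × ⋯ × Δ^{{k}}`. -/
noncomputable def basePoint (k : ℕ) : (simplices k).obj (base k) :=
  fun i => stdSimplex.vertex (S := ℝ) (⟨i, rfl⟩ : (base k).fibre i)

/-- The straight-line homotopy from the inclusion of the back part to the base point of the
front part. -/
noncomputable def contract (A : QObj k) :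
    C(I × (simplices k).obj A, (simplices k).obj A.prepend) where
  toFun p i := stdSimplex.segment p.1 ((simplices k).map A.prependInl (basePoint k) i)
    ((simplices k).map A.prependInr p.2 i)
  continuous_toFun := continuous_pi fun i =>
    (stdSimplex.continuous_segment ((simplices k).map A.prependInl (basePoint k) i)).comp
      (continuous_fst.prodMk ((continuous_apply i).comp
        (((simplices k).map A.prependInr).hom.continuous.comp continuous_snd)))

lemma contract_zero (A : QObj k) (u : (simplices k).obj A) :
    A.contract (0, u) = (simplices k).map A.prependInr u :=
  funext fun _ => stdSimplex.segment_zero _ _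

lemma contract_one (A : QObj k) (u : (simplices k).obj A) :
    A.contract (1, u) = (simplices k).map A.prependInl (basePoint k) :=
  funext fun _ => stdSimplex.segment_one _ _

/-- Induced maps of simplices are affine, hence preserve segments, and both endpoints are natural
because `prependMap h` is the identity in front and `h` behind. -/
lemma map_contract {A B : QObj k} (h : A ⟶ B) (t : I) (u : (simplices k).obj A) :
    (simplices k).map (prependMap h) (A.contract (t, u)) =
      B.contract (t, (simplices k).map h u) := by
  have hl : (simplices k).map (prependMap h) ((simplices k).map A.prependInl (basePoint k)) =
      (simplices k).map B.prependInl (basePoint k) := by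
    rw [← prependInl_comp_prependMap h, Functor.map_comp]; rfl
  have hr : (simplices k).map (prependMap h) ((simplices k).map A.prependInr u) =
      (simplices k).map B.prependInr ((simplices k).map h u) := by
    rw [← TopCat.comp_app, ← TopCat.comp_app, ← Functor.map_comp, ← Functor.map_comp,
      prependInr_comp_prependMap]
  funext i
  refine (stdSimplex.map_segment _ _ _ _).trans ?_
  exact congrArg₂ (stdSimplex.segment t) (congrFun hl i) (congrFun hr i)

/-- The unique morphism from `S` to `[0]`. -/
def toPoint (A : QObj k) : (forget k).obj A ⟶ ordinalSet 0 :=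
  (⟨fun _ => 0, fun _ _ _ => le_rfl⟩ : A.set →o Fin 1)

lemma toPoint_unique {A : QObj k} (p : (forget k).obj A ⟶ ordinalSet 0) : p = A.toPoint :=
  OrderHom.ext _ _ (funext fun _ => Subsingleton.elim (α := Fin 1) _ _)

end QObj

namespace XiSimplex

open QObj

variable {k : ℕ}

/-- The colimit cocone whose point is `Y_k^0`. -/
noncomputable abbrev cocone (k : ℕ) :
    Cocone (CostructuredArrow.proj (forget k) (ordinalSet 0) ⋙ simplices k) :=
  (Functor.LeftExtension.mk _ ((forget k).leftKanExtensionUnit (simplices k))).coconeAt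
    (ordinalSet 0)

/-- `Y_k^0` is a colimit over `Q_k`. -/
noncomputable def isColimit (k : ℕ) : IsColimit (cocone k) :=
  Functor.isPointwiseLeftKanExtensionOfIsLeftKanExtension _
    ((forget k).leftKanExtensionUnit (simplices k)) (ordinalSet 0)

/-- The canonical map to `Y_k^0`. -/
noncomputable def incl (A : QObj k) : (simplices k).obj A ⟶ (XiSimplex k).obj (ordinalSet 0) :=
  (cocone k).ι.app (CostructuredArrow.mk A.toPoint)

lemma map_incl {A B : QObj k} (h : A ⟶ B) (u : (simplices k).obj A) :
    incl B ((simplices k).map h u) = incl A u :=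
  ConcreteCategory.congr_hom ((cocone k).w
    (CostructuredArrow.homMk (f := CostructuredArrow.mk A.toPoint)
      (f' := CostructuredArrow.mk B.toPoint) h (toPoint_unique _))) u

/-- The straight-line homotopies, as a cocone with point the space of paths in `Y_k^0`. -/
noncomputable def pathCocone (k : ℕ) :
    Cocone (CostructuredArrow.proj (forget k) (ordinalSet 0) ⋙ simplices k) where
  -- With paths as the target, the universal property applies to `Y_k^0` itself, rather than to its
  -- product with `I`.
  pt := TopCat.of C(I, (XiSimplex k).obj (ordinalSet 0))
  ι :=
    { app := fun j => TopCat.ofHom (ContinuousMap.curry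
        (((incl j.left.prepend).hom.comp j.left.contract).comp ContinuousMap.prodSwap))
      naturality := fun j j' φ => by
        refine TopCat.hom_ext (ContinuousMap.ext fun u => ContinuousMap.ext fun t => ?_)
        refine Eq.trans ?_ (map_incl (prependMap φ.left) (j.left.contract (t, u)))
        exact congrArg (incl j'.left.prepend) (map_contract φ.left t u).symm }

/-- The homotopy on `Y_k^0`, as a map to the space of paths. -/
noncomputable def pathMap (k : ℕ) :
    C((XiSimplex k).obj (ordinalSet 0), C(I, (XiSimplex k).obj (ordinalSet 0))) :=
  ((isColimit k).desc (pathCocone k)).hom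

lemma pathMap_incl (A : QObj k) (u : (simplices k).obj A) (t : I) :
    pathMap k (incl A u) t = incl A.prepend (A.contract (t, u)) := by
  have h : pathMap k (incl A u) =
      ((pathCocone k).ι.app (CostructuredArrow.mk A.toPoint)).hom u :=
    ConcreteCategory.congr_hom
      ((isColimit k).fac (pathCocone k) (CostructuredArrow.mk A.toPoint)) u
  exact DFunLike.congr_fun h t

/-- Colimits in `Top` are jointly covered by their legs, so the ends of the homotopy can be checked
on representatives. -/
lemma exists_incl_eq (y : (XiSimplex k).obj (ordinalSet 0)) :
    ∃ (A : QObj k) (u : (simplices k).obj A), incl A u = y := by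
  obtain ⟨j, u, rfl⟩ := Concrete.isColimit_exists_rep _ (isColimit k) y
  obtain ⟨A, ⟨⟩, p⟩ := j
  obtain rfl := toPoint_unique p
  exact ⟨A, u, rfl⟩

end XiSimplex

open QObj XiSimplex in
theorem corollary10p6 (k : ℕ) : ContractibleSpace ((XiSimplex k).obj (ordinalSet 0)) := by
  rw [contractible_iff_id_nullhomotopic]
  -- Uncurrying is continuous because `I` is locally compact.
  refine ⟨incl (base k) (basePoint k), ⟨⟨(pathMap k).uncurry.comp .prodSwap, fun y => ?_,
    fun y => ?_⟩⟩⟩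
  · obtain ⟨A, u, rfl⟩ := exists_incl_eq y
    refine (pathMap_incl A u 0).trans ?_
    rw [contract_zero, map_incl]
    rfl
  · obtain ⟨A, u, rfl⟩ := exists_incl_eq y
    refine (pathMap_incl A u 1).trans ?_
    -- Here `map_incl` is used along `prependInl`, which removes the dependence on `A`.
    rw [contract_one, map_incl]
    rfl
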